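/- Let $S_1^3$ be the half-space $\{(x_1,x_2,x_3):x_3>0\}$ with the Lorentz metric $(dx_1^2+dx_2^2-dx_3^2)/x_3^2$, identified with the Lie group with product $x\cdot y=(x_1+x_3y_1,\;x_2+x_3y_2,\;x_3y_3)$ and identity $e=(0,0,1)$. For a space-like surface $x$ in $S_1^3$ with time-like unit normal $N$ (normalized by $\langle N,N\rangle=-1$) and second fundamental form $\mathrm{II}$ with respect to $N$, the normal Gauss map is $\widetilde N=(L_{x^{-1}})_*N\in T_eS_1^3=L^3$, and the fourth fundamental form is $\mathrm{IV}=\langle d\widetilde N,d\widetilde N\rangle$, taken with the Minkowski product $dx_1^2+dx_2^2-dx_3^2$. The normal Gauss map is called conformal if $\mathrm{IV}=\rho\,\mathrm{II}$ for some smooth function $\rho$. **Theorem.** Let $U\subset\mathbb R^2$ be nonempty, open and connected, and let $f:U\to(0,\infty)$ be smooth. The following are equivalent. 1. The graph $(u,v,f(u,v))$, $(u,v)\in U$, is a space-like surface in $S_1^3$ with conformal normal Gauss map, it is translational, i.e. $f(u,v)=\varphi(u)+\psi(v)$ on $U$ for some functions $\varphi,\psi$, and it is nontrivial, i.e. not part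 of a plane ($f$ is not of the form $\alpha u+\beta v+\gamma$ on $U$). 2. $f_u^2+f_v^2<1$ on $U$, and there are nonzero constants $a,b$ and constants $u_0,v_0$ such that, on all of $U$, one of $$f(u,v)=\sqrt{a^2+(u-u_0)^2}\pm\sqrt{b^2+(v-v_0)^2},\qquad f(u,v)=\sqrt{b^2+(v-v_0)^2}-\sqrt{a^2+(u-u_0)^2}$$ holds. 3. There are nonzero constants $a,b$ (of any sign), constants $u_0,v_0$ and an open set $D\subset\mathbb R^2$ such that $$x(s,t)=(u_0+a\sinh s,\;v_0+b\sinh t,\;a\cosh s+b\cosh t)$$ is an injective space-like immersion on $D$ whose image $x(D)$ is the graph of $f$ over $U$. -/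

import Mathlib

open scoped ContDiff

namespace DeSitter

noncomputable section

/-- The upper half-space `{x₃ > 0}` of `ℝ³` (coordinates are indexed by `0, 1, 2`), which carries
the half-space model of the de Sitter space `S₁³`. -/
def halfSpace : Set (Fin 3 → ℝ) := {x | 0 < x 2}

/-- The Lorentz-Minkowski product `X₁Y₁ + X₂Y₂ - X₃Y₃` of `L³`. -/
def minkowski (X Y : Fin 3 → ℝ) : ℝ := X 0 * Y 0 + X 1 * Y 1 - X 2 * Y 2

/-- The de Sitter metric `(dx₁² + dx₂² - dx₃²) / x₃²` at the point `x` of the half-space. -/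
def metric (x X Y : Fin 3 → ℝ) : ℝ := minkowski X Y / x 2 ^ 2

/-- The coefficients `g_AB` of the de Sitter metric in the half-space coordinates. -/
def metricMatrix (x : Fin 3 → ℝ) : Matrix (Fin 3) (Fin 3) ℝ :=
  Matrix.of fun A B => metric x (Pi.single A 1) (Pi.single B 1)

/-- The partial derivative `∂_A g_BC` of a coefficient of the metric. -/
def dMetric (x : Fin 3 → ℝ) (A B C : Fin 3) : ℝ :=
  fderiv ℝ (fun y => metricMatrix y B C) x (Pi.single A 1)

/-- The Christoffel symbols `Γ^C_AB = ½ g^CD (∂_A g_BD + ∂_B g_AD - ∂_D g_AB)` of the Levi-Civita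
connection of the de Sitter metric. -/
def christoffel (x : Fin 3 → ℝ) (C A B : Fin 3) : ℝ :=
  (1 / 2) * ∑ D, (metricMatrix x)⁻¹ C D * (dMetric x A B D + dMetric x B A D - dMetric x D A B)

/-- The derivative `∂_w x` of a parametrized surface `x` in the parameter direction `w`. -/
def tangent (x : ℝ × ℝ → Fin 3 → ℝ) (p w : ℝ × ℝ) : Fin 3 → ℝ := fderiv ℝ x p w

/-- The ambient covariant derivative of the tangent field `∂_z x` (`z` a constant direction in
the parameter plane) in the direction `w`, along the surface `x`. -/
def covDeriv (x : ℝ × ℝ → Fin 3 → ℝ) (p w z : ℝ × ℝ) : Fin 3 → ℝ := fun C =>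
  fderiv ℝ (fun q => tangent x q z) p w C +
    ∑ A, ∑ B, christoffel (x p) C A B * tangent x p w A * tangent x p z B

/-- `x` restricted to `U` is a space-like immersed surface: the induced metric (the first
fundamental form) is positive definite. -/
def IsSpacelike (x : ℝ × ℝ → Fin 3 → ℝ) (U : Set (ℝ × ℝ)) : Prop :=
  ∀ p ∈ U, ∀ w : ℝ × ℝ, w ≠ 0 → 0 < metric (x p) (tangent x p w) (tangent x p w)

/-- `N` is a smooth time-like unit normal vector field along the surface `x` on `U`. -/
def IsUnitNormal (x N : ℝ × ℝ → Fin 3 → ℝ) (U : Set (ℝ × ℝ)) : Prop :=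
  ContDiffOn ℝ ∞ N U ∧ ∀ p ∈ U,
    metric (x p) (N p) (N p) = -1 ∧ ∀ w : ℝ × ℝ, metric (x p) (N p) (tangent x p w) = 0

/-- The second fundamental form with respect to `N`: the coefficient of `N` in the ambient
covariant derivative of tangent fields (recall that `N` has square `-1`). -/
def secondForm (x N : ℝ × ℝ → Fin 3 → ℝ) (p w z : ℝ × ℝ) : ℝ :=
  -metric (x p) (covDeriv x p w z) (N p)

/-- The multiplication of the Lie group with underlying set the half-space and identity
`e = (0, 0, 1)`; it is the product of the matrices
`!![1, 0, 0, log x₃; 0, x₃, 0, x₁; 0, 0, x₃, x₂; 0, 0, 0, 1]`. -/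
def groupMul (x y : Fin 3 → ℝ) : Fin 3 → ℝ :=
  ![x 2 * y 0 + x 0, x 2 * y 1 + x 1, x 2 * y 2]

/-- The inverse in the Lie group on the half-space. -/
def groupInv (x : Fin 3 → ℝ) : Fin 3 → ℝ := ![-(x 0 / x 2), -(x 1 / x 2), 1 / x 2]

/-- The normal Gauss map: the unit normal `N` at the point `x`, carried to the tangent space at
the identity by the differential of the left translation by `x⁻¹`. -/
def normalGaussMap (x N : ℝ × ℝ → Fin 3 → ℝ) (p : ℝ × ℝ) : Fin 3 → ℝ :=
  fderiv ℝ (fun y => groupMul (groupInv (x p)) y) (x p) (N p)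

/-- The fourth fundamental form: the pullback of the Lorentz-Minkowski product under the normal
Gauss map. -/
def fourthForm (x N : ℝ × ℝ → Fin 3 → ℝ) (p w z : ℝ × ℝ) : ℝ :=
  minkowski (fderiv ℝ (normalGaussMap x N) p w) (fderiv ℝ (normalGaussMap x N) p z)

/-- The normal Gauss map of the surface `x` on `U` is conformal: `IV = ρ II` for a smooth
function `ρ`. (Replacing `N` by `-N` keeps `IV` and changes the sign of `II`, so the choice of the
unit normal is immaterial.) -/
def HasConformalNormalGaussMap (x : ℝ × ℝ → Fin 3 → ℝ) (U : Set (ℝ × ℝ)) : Prop :=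
  ∃ N : ℝ × ℝ → Fin 3 → ℝ, IsUnitNormal x N U ∧
    ∃ ρ : ℝ × ℝ → ℝ, ContDiffOn ℝ ∞ ρ U ∧
      ∀ p ∈ U, ∀ w z : ℝ × ℝ, fourthForm x N p w z = ρ p * secondForm x N p w z

/-- The graph surface `(u, v) ↦ (u, v, f(u, v))`. -/
def graphSurface (f : ℝ × ℝ → ℝ) (p : ℝ × ℝ) : Fin 3 → ℝ := ![p.1, p.2, f p]

/-- `f` is translational on `U`: `f(u, v) = φ(u) + ψ(v)`. -/
def IsTranslational (f : ℝ × ℝ → ℝ) (U : Set (ℝ × ℝ)) : Prop :=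
  ∃ φ ψ : ℝ → ℝ, ∀ p ∈ U, f p = φ p.1 + ψ p.2

/-- The graph of `f` over `U` is part of a Euclidean plane (the trivial case). -/
def IsPlanar (f : ℝ × ℝ → ℝ) (U : Set (ℝ × ℝ)) : Prop :=
  ∃ α β γ : ℝ, ∀ p ∈ U, f p = α * p.1 + β * p.2 + γ

/-- The surface `(a sinh s, b sinh t, a cosh s + b cosh t)`, translated by `(u₀, v₀, 0)`. -/
def sinhCoshSurface (a b u₀ v₀ : ℝ) (q : ℝ × ℝ) : Fin 3 → ℝ :=
  ![u₀ + a * Real.sinh q.1, v₀ + b * Real.sinh q.2, a * Real.cosh q.1 + b * Real.cosh q.2]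

end

end DeSitter

/-! ### The Levi-Civita connection of the half-space metric -/

namespace DeSitter

/-! Write `P = φ'`, `Q = ψ'`, `r = φ''`, `s = ψ''` and `W = 1 - P² - Q²`. The graph is space-like
iff `W > 0`, and `N` is a multiple of `(P, Q, 1)`. Up to nonzero scalar factors, the matrix of II
has entries `f r - 1 + P²`, `PQ`, `f s - 1 + Q²`, and that of IV has entries `r² (1 - Q²)`, `r s P
Q`, `s² (1 - P²)` (`secondForm_eq`, `fourthForm_eq`). Where `PQ ≠ 0` the off-diagonal entries force
the ratio `r s`, and conformality becomes `r (1 - Q²) + s (1 - P²) = f r s`; continuity extends this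
to all of `U` (`conformal_equation`). Conversely, the equation makes `r s` a valid ratio everywhere.

The equation shows that `r` and `s` vanish together. Vanishing somewhere then means vanishing
everywhere, which gives a plane. Otherwise division by `r s` separates the variables: up to opposite
additive constants, `φ` and `ψ` solve `g g'' + g'² = 1`, that is `(g²)'' = 2`
(`eq_branch_add_branch`). With `g'² < 1`, the solutions are branches of hyperbolas `g² = (u - u₀)² +
a²`.

Letting the sign of `a` select the branch turns the three formulas and the hyperbolic
parametrization into one statement, `f = branch a u₀ + branch b v₀`. -/

theorem metricMatrix_eq (x : Fin 3 → ℝ) :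
    metricMatrix x = Matrix.diagonal ![1 / x 2 ^ 2, 1 / x 2 ^ 2, -(1 / x 2 ^ 2)] := by
  ext A B
  fin_cases A <;> fin_cases B <;>
    simp [metricMatrix, metric, minkowski, Matrix.diagonal, Pi.single_apply, neg_div]

theorem metricMatrix_inv (x : Fin 3 → ℝ) (hx : 0 < x 2) :
    (metricMatrix x)⁻¹ = Matrix.diagonal ![x 2 ^ 2, x 2 ^ 2, -(x 2 ^ 2)] := by
  apply Matrix.inv_eq_right_inv
  rw [metricMatrix_eq, Matrix.diagonal_mul_diagonal, ← Matrix.diagonal_one]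
  congr 1
  ext i
  have := hx.ne'
  fin_cases i <;> simp [this]

theorem hasFDerivAt_one_div_sq (x : Fin 3 → ℝ) (hx : 0 < x 2) :
    HasFDerivAt (fun y : Fin 3 → ℝ => 1 / y 2 ^ 2)
      ((-2 / x 2 ^ 3) • (ContinuousLinearMap.proj 2 : (Fin 3 → ℝ) →L[ℝ] ℝ)) x := by
  have h1 : HasDerivAt (fun t : ℝ => 1 / t ^ 2) (-2 / x 2 ^ 3) (x 2) := by
    have h := (hasDerivAt_pow 2 (x 2)).inv (by positivity)
    have hx' := hx.ne'
    have e : (-2 / x 2 ^ 3 : ℝ) = -(((2 : ℕ) : ℝ) * x 2 ^ (2 - 1)) / (x 2 ^ 2) ^ 2 := by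
      norm_num
      field_simp
    rw [e]
    simp only [one_div]
    exact h
  exact HasDerivAt.comp_hasFDerivAt (f := fun y : Fin 3 → ℝ => y 2) x h1
    (ContinuousLinearMap.proj 2 : (Fin 3 → ℝ) →L[ℝ] ℝ).hasFDerivAt

theorem dMetric_eq (x : Fin 3 → ℝ) (hx : 0 < x 2) (A B C : Fin 3) :
    dMetric x A B C = Matrix.diagonal (![1, 1, -1] : Fin 3 → ℝ) B C *
      (-2 / x 2 ^ 3 * (Pi.single A 1 : Fin 3 → ℝ) 2) := by
  have h : (fun y : Fin 3 → ℝ => metricMatrix y B C) =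
      fun y => Matrix.diagonal (![1, 1, -1] : Fin 3 → ℝ) B C * (1 / y 2 ^ 2) := by
    ext y
    rw [metricMatrix_eq]
    fin_cases B <;> fin_cases C <;> simp [Matrix.diagonal]
  rw [dMetric, h, ((hasFDerivAt_one_div_sq x hx).const_mul _).fderiv]
  simp

/-- The metric is conformal to the flat one with factor `1 / x₃²`, so only derivatives of `-log x₃`
enter. The last term has a plus sign because `e₃` is time-like. -/
theorem sum_christoffel (x X Z : Fin 3 → ℝ) (hx : 0 < x 2) (C : Fin 3) :
    ∑ A, ∑ B, christoffel x C A B * X A * Z B =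
      -(1 / x 2) * (X 2 * Z C + Z 2 * X C + (Pi.single 2 (minkowski X Z) : Fin 3 → ℝ) C) := by
  have := hx.ne'
  fin_cases C <;>
  · simp [christoffel, metricMatrix_inv x hx, dMetric_eq x hx, Fin.sum_univ_three,
      Matrix.diagonal, Pi.single_apply, minkowski]
    field_simp
    ring

/-! ### Fundamental forms of a translational graph -/

/-- `f` is the sum of a smooth function of the first variable and a smooth function of the
second one, on `U`. -/
structure IsSmoothSum (f : ℝ × ℝ → ℝ) (U : Set (ℝ × ℝ)) (φ ψ : ℝ → ℝ) : Prop where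
  eq : ∀ p ∈ U, f p = φ p.1 + ψ p.2
  left : ∀ p ∈ U, ContDiffAt ℝ ∞ φ p.1
  right : ∀ p ∈ U, ContDiffAt ℝ ∞ ψ p.2

theorem _root_.ContDiffAt.hasDerivAt_deriv {φ : ℝ → ℝ} {u : ℝ} (h : ContDiffAt ℝ ∞ φ u) :
    HasDerivAt φ (deriv φ u) u :=
  (h.differentiableAt (by simp)).hasDerivAt

theorem _root_.ContDiffAt.deriv_infty {φ : ℝ → ℝ} {u : ℝ} (h : ContDiffAt ℝ ∞ φ u) :
    ContDiffAt ℝ ∞ (deriv φ) u :=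
  h.derivWithin le_rfl

theorem _root_.HasDerivAt.comp_fst {φ : ℝ → ℝ} {φ' : ℝ} {p : ℝ × ℝ} (h : HasDerivAt φ φ' p.1) :
    HasFDerivAt (fun q : ℝ × ℝ => φ q.1) (φ' • ContinuousLinearMap.fst ℝ ℝ ℝ) p :=
  HasDerivAt.comp_hasFDerivAt (f := fun q : ℝ × ℝ => q.1) p h hasFDerivAt_fst

theorem _root_.HasDerivAt.comp_snd {φ : ℝ → ℝ} {φ' : ℝ} {p : ℝ × ℝ} (h : HasDerivAt φ φ' p.2) :
    HasFDerivAt (fun q : ℝ × ℝ => φ q.2) (φ' • ContinuousLinearMap.snd ℝ ℝ ℝ) p :=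
  HasDerivAt.comp_hasFDerivAt (f := fun q : ℝ × ℝ => q.2) p h hasFDerivAt_snd

/-- Left translation by `x⁻¹` is an affine map whose linear part is the homothety of ratio `1 / x₃`.
-/
theorem normalGaussMap_eq (x N : ℝ × ℝ → Fin 3 → ℝ) (p : ℝ × ℝ) :
    normalGaussMap x N p = (1 / x p 2) • N p := by
  have h : (fun y => groupMul (groupInv (x p)) y) = fun y => (1 / x p 2) • y + ![-(x p 0 / x p 2), -(x p 1 / x p 2), 0] := by
    ext y i
    fin_cases i <;> simp [groupMul, groupInv]
  have h1 : HasFDerivAt (fun y : Fin 3 → ℝ =>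
      (1 / x p 2) • y + ![-(x p 0 / x p 2), -(x p 1 / x p 2), 0])
      ((1 / x p 2) • ContinuousLinearMap.id ℝ (Fin 3 → ℝ)) (x p) :=
    ((hasFDerivAt_id (x p)).const_smul (1 / x p 2)).add_const _
  rw [normalGaussMap, h, h1.fderiv]
  simp

namespace IsSmoothSum

variable {f : ℝ × ℝ → ℝ} {U : Set (ℝ × ℝ)} {φ ψ : ℝ → ℝ} {p : ℝ × ℝ}

theorem hasFDerivAt (h : IsSmoothSum f U φ ψ) (hU : IsOpen U) (hp : p ∈ U) :
    HasFDerivAt f (deriv φ p.1 • ContinuousLinearMap.fst ℝ ℝ ℝ +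
      deriv ψ p.2 • ContinuousLinearMap.snd ℝ ℝ ℝ) p := by
  have h1 := (h.left p hp).hasDerivAt_deriv.comp_fst.add (h.right p hp).hasDerivAt_deriv.comp_snd
  refine h1.congr_of_eventuallyEq ?_
  filter_upwards [hU.mem_nhds hp] with q hq using h.eq q hq

theorem tangent_graphSurface (h : IsSmoothSum f U φ ψ) (hU : IsOpen U) (hp : p ∈ U) (w : ℝ × ℝ) :
    tangent (graphSurface f) p w = ![w.1, w.2, deriv φ p.1 * w.1 + deriv ψ p.2 * w.2] := by
  have h1 : HasFDerivAt (graphSurface f) (ContinuousLinearMap.pi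
      ![ContinuousLinearMap.fst ℝ ℝ ℝ, ContinuousLinearMap.snd ℝ ℝ ℝ,
        deriv φ p.1 • ContinuousLinearMap.fst ℝ ℝ ℝ +
          deriv ψ p.2 • ContinuousLinearMap.snd ℝ ℝ ℝ]) p := by
    rw [hasFDerivAt_pi]
    intro i
    fin_cases i
    · exact hasFDerivAt_fst
    · exact hasFDerivAt_snd
    · exact h.hasFDerivAt hU hp
  rw [tangent, h1.fderiv]
  ext i
  fin_cases i <;> simp

theorem metric_tangent (h : IsSmoothSum f U φ ψ) (hU : IsOpen U) (hp : p ∈ U) (w : ℝ × ℝ) :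
    metric (graphSurface f p) (tangent (graphSurface f) p w) (tangent (graphSurface f) p w) =
      (w.1 ^ 2 + w.2 ^ 2 - (deriv φ p.1 * w.1 + deriv ψ p.2 * w.2) ^ 2) / f p ^ 2 := by
  rw [h.tangent_graphSurface hU hp]
  simp [metric, minkowski, graphSurface]
  ring

theorem fderiv_tangent (h : IsSmoothSum f U φ ψ) (hU : IsOpen U) (hp : p ∈ U) (w z : ℝ × ℝ) :
    fderiv ℝ (fun q => tangent (graphSurface f) q z) p w =
      ![0, 0, deriv (deriv φ) p.1 * w.1 * z.1 + deriv (deriv ψ) p.2 * w.2 * z.2] := by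
  have h1 : HasFDerivAt (fun q : ℝ × ℝ =>
      (![z.1, z.2, deriv φ q.1 * z.1 + deriv ψ q.2 * z.2] : Fin 3 → ℝ))
      (ContinuousLinearMap.pi
      ![0, 0, z.1 • deriv (deriv φ) p.1 • ContinuousLinearMap.fst ℝ ℝ ℝ +
          z.2 • deriv (deriv ψ) p.2 • ContinuousLinearMap.snd ℝ ℝ ℝ]) p := by
    rw [hasFDerivAt_pi]
    intro i
    fin_cases i
    · exact hasFDerivAt_const _ _
    · exact hasFDerivAt_const _ _
    · exact ((h.left p hp).deriv_infty.hasDerivAt_deriv.comp_fst.mul_const z.1).add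
        ((h.right p hp).deriv_infty.hasDerivAt_deriv.comp_snd.mul_const z.2)
  have h2 := h1.congr_of_eventuallyEq (f₁ := fun q => tangent (graphSurface f) q z) (by
    filter_upwards [hU.mem_nhds hp] with q hq using h.tangent_graphSurface hU hq z)
  rw [h2.fderiv]
  ext i
  fin_cases i <;> simp
  ring

/-- The components of a unit normal field of the graph. -/
theorem unitNormal (h : IsSmoothSum f U φ ψ) (hU : IsOpen U) (hp : p ∈ U) (hpos : 0 < f p)
    {N : ℝ × ℝ → Fin 3 → ℝ} (hN : IsUnitNormal (graphSurface f) N U) :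
    N p 0 = deriv φ p.1 * N p 2 ∧ N p 1 = deriv ψ p.2 * N p 2 ∧
      N p 2 ^ 2 * (1 - deriv φ p.1 ^ 2 - deriv ψ p.2 ^ 2) = f p ^ 2 := by
  obtain ⟨h1, h2⟩ := hN.2 p hp
  have h3 := h2 (1, 0)
  have h4 := h2 (0, 1)
  rw [h.tangent_graphSurface hU hp] at h3 h4
  have hne := hpos.ne'
  simp [metric, minkowski, graphSurface, hne] at h1 h3 h4
  have h5 : N p 0 = deriv φ p.1 * N p 2 := by linarith
  have h6 : N p 1 = deriv ψ p.2 * N p 2 := by linarith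
  refine ⟨h5, h6, ?_⟩
  rw [h5, h6] at h1
  field_simp at h1
  linarith

theorem secondForm_eq (h : IsSmoothSum f U φ ψ) (hU : IsOpen U) (hp : p ∈ U) (hpos : 0 < f p)
    {N : ℝ × ℝ → Fin 3 → ℝ} (hN : IsUnitNormal (graphSurface f) N U) (w z : ℝ × ℝ) :
    secondForm (graphSurface f) N p w z = N p 2 / f p ^ 3 *
      (w.1 * z.1 * (f p * deriv (deriv φ) p.1 - 1 + deriv φ p.1 ^ 2) +
        (w.1 * z.2 + w.2 * z.1) * (deriv φ p.1 * deriv ψ p.2) +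
        w.2 * z.2 * (f p * deriv (deriv ψ) p.2 - 1 + deriv ψ p.2 ^ 2)) := by
  obtain ⟨h0, h1, -⟩ := h.unitNormal hU hp hpos hN
  have hc : covDeriv (graphSurface f) p w z = fun C =>
      (![0, 0, deriv (deriv φ) p.1 * w.1 * z.1 + deriv (deriv ψ) p.2 * w.2 * z.2] : Fin 3 → ℝ) C +
      -(1 / f p) * ((deriv φ p.1 * w.1 + deriv ψ p.2 * w.2) * tangent (graphSurface f) p z C +
        (deriv φ p.1 * z.1 + deriv ψ p.2 * z.2) * tangent (graphSurface f) p w C +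
        (Pi.single 2 (minkowski (tangent (graphSurface f) p w) (tangent (graphSurface f) p z)) :
          Fin 3 → ℝ) C) := by
    ext C
    rw [covDeriv, h.fderiv_tangent hU hp, sum_christoffel _ _ _ (by simpa [graphSurface] using hpos)]
    rw [h.tangent_graphSurface hU hp, h.tangent_graphSurface hU hp]
    simp [graphSurface]
  rw [secondForm, hc, h.tangent_graphSurface hU hp, h.tangent_graphSurface hU hp]
  have hne := hpos.ne'
  simp [metric, minkowski, graphSurface, h0, h1]
  field_simp
  ring

theorem fourthForm_eq (h : IsSmoothSum f U φ ψ) (hU : IsOpen U) (hpos : ∀ q ∈ U, 0 < f q)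
    (hp : p ∈ U) {N : ℝ × ℝ → Fin 3 → ℝ} (hN : IsUnitNormal (graphSurface f) N U) (w z : ℝ × ℝ) :
    fourthForm (graphSurface f) N p w z =
      (w.1 * z.1 * (deriv (deriv φ) p.1 ^ 2 * (1 - deriv ψ p.2 ^ 2)) +
        (w.1 * z.2 + w.2 * z.1) *
          (deriv (deriv φ) p.1 * deriv (deriv ψ) p.2 * (deriv φ p.1 * deriv ψ p.2)) +
        w.2 * z.2 * (deriv (deriv ψ) p.2 ^ 2 * (1 - deriv φ p.1 ^ 2))) /
      (1 - deriv φ p.1 ^ 2 - deriv ψ p.2 ^ 2) ^ 2 := by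
  set l : ℝ × ℝ → ℝ := fun q => N q 2 / f q with hl
  have hUp := hU.mem_nhds hp
  have hld : DifferentiableAt ℝ l p := by
    have h1 : DifferentiableAt ℝ N p := (hN.1.contDiffAt hUp).differentiableAt (by simp)
    have h2 : DifferentiableAt ℝ (fun q => N q 2) p := differentiableAt_pi.1 h1 2
    have h3 := h2.mul ((h.hasFDerivAt hU hp).differentiableAt.inv (hpos p hp).ne')
    exact h3
  have hL := hld.hasFDerivAt
  set L := fderiv ℝ l p
  have hP := (h.left p hp).deriv_infty.hasDerivAt_deriv.comp_fst
  have hQ := (h.right p hp).deriv_infty.hasDerivAt_deriv.comp_snd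
  -- The Gauss map is `l (φ', ψ', 1)`. Its normalization determines `dl` by differentiation, with no
  -- choice of sign for `l`.
  have hsq : ∀ q ∈ U, l q ^ 2 * (1 - deriv φ q.1 ^ 2 - deriv ψ q.2 ^ 2) = 1 := by
    intro q hq
    have h1 := (h.unitNormal hU hq (hpos q hq) hN).2.2
    have h2 := (hpos q hq).ne'
    simp only [hl]
    field_simp
    exact h1
  have hLw : ∀ w : ℝ × ℝ, L w * (1 - deriv φ p.1 ^ 2 - deriv ψ p.2 ^ 2) =
      l p * (deriv φ p.1 * (deriv (deriv φ) p.1 * w.1) +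
        deriv ψ p.2 * (deriv (deriv ψ) p.2 * w.2)) := by
    intro w
    have h1 := (hL.pow 2).mul (((hasFDerivAt_const (𝕜 := ℝ) (1 : ℝ) p).sub (hP.pow 2)).sub (hQ.pow 2))
    have h2 := (hasFDerivAt_const (𝕜 := ℝ) (1 : ℝ) p).congr_of_eventuallyEq
      (f₁ := fun q => l q ^ 2 * (1 - deriv φ q.1 ^ 2 - deriv ψ q.2 ^ 2)) (by
        filter_upwards [hUp] with q hq using hsq q hq)
    have h3 := congrArg (fun T : ℝ × ℝ →L[ℝ] ℝ => T w) (h1.unique h2)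
    simp at h3
    have h4 : l p ≠ 0 := by
      intro h5
      simpa [h5] using hsq p hp
    have h5 : 2 * l p ≠ 0 := by simpa using h4
    apply mul_left_cancel₀ h5
    linarith
  have hG : ∀ w, fderiv ℝ (normalGaussMap (graphSurface f) N) p w =
      ![L w * deriv φ p.1 + l p * (deriv (deriv φ) p.1 * w.1),
        L w * deriv ψ p.2 + l p * (deriv (deriv ψ) p.2 * w.2), L w] := by
    intro w
    have h1 : HasFDerivAt (fun q : ℝ × ℝ =>
        (![l q * deriv φ q.1, l q * deriv ψ q.2, l q] : Fin 3 → ℝ))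
        (ContinuousLinearMap.pi
          ![l p • deriv (deriv φ) p.1 • ContinuousLinearMap.fst ℝ ℝ ℝ + deriv φ p.1 • L,
            l p • deriv (deriv ψ) p.2 • ContinuousLinearMap.snd ℝ ℝ ℝ + deriv ψ p.2 • L, L]) p := by
      rw [hasFDerivAt_pi]
      intro i
      fin_cases i
      · exact hL.mul hP
      · exact hL.mul hQ
      · exact hL
    have h2 := h1.congr_of_eventuallyEq (f₁ := normalGaussMap (graphSurface f) N) (by
      filter_upwards [hUp] with q hq
      obtain ⟨h0, h1, -⟩ := h.unitNormal hU hq (hpos q hq) hN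
      rw [normalGaussMap_eq]
      ext i
      fin_cases i <;> simp [graphSurface, h0, h1, hl] <;> ring)
    rw [h2.fderiv]
    ext i
    fin_cases i <;> simp <;> ring
  have hW : 1 - deriv φ p.1 ^ 2 - deriv ψ p.2 ^ 2 ≠ 0 := by
    intro h5
    simpa [h5] using hsq p hp
  have hs := hsq p hp
  rw [fourthForm, hG, hG]
  have hw := hLw w
  have hz := hLw z
  simp [minkowski]
  rw [eq_div_iff (pow_ne_zero 2 hW)]
  generalize deriv (deriv φ) p.1 = r at *
  generalize deriv (deriv ψ) p.2 = s at *
  generalize deriv φ p.1 = P at *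
  generalize deriv ψ p.2 = Q at *
  generalize l p = m at *
  generalize L w = a at *
  generalize L z = b at *
  -- With `α = P r w₁ + Q s w₂`, `β = P r z₁ + Q s z₂` and `W = 1 - P² - Q²`, the left side is `-W
  -- (aW - mα)(bW - mβ) + m² W (αβ + W (r² w₁ z₁ + s² w₂ z₂))`. The first term vanishes by `hw`, and
  -- `m² W = 1` by `hs`.
  linear_combination (-((1 - P ^ 2 - Q ^ 2) * (b * (1 - P ^ 2 - Q ^ 2) -
      m * (P * (r * z.1) + Q * (s * z.2))))) * hw +
    ((P * (r * w.1) + Q * (s * w.2)) * (P * (r * z.1) + Q * (s * z.2)) +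
      (1 - P ^ 2 - Q ^ 2) * (r * w.1 * (r * z.1) + s * w.2 * (s * z.2))) * hs

end IsSmoothSum

/-- Near each point a summand is a slice of `f` minus a constant, so it inherits smoothness from
`f`. -/
theorem isSmoothSum_of_isTranslational {f : ℝ × ℝ → ℝ} {U : Set (ℝ × ℝ)} (hU : IsOpen U)
    (hf : ContDiffOn ℝ ∞ f U) {φ ψ : ℝ → ℝ} (h : ∀ p ∈ U, f p = φ p.1 + ψ p.2) :
    IsSmoothSum f U φ ψ := by
  refine ⟨h, fun p hp => ?_, fun p hp => ?_⟩
  · have h1 : ContDiffAt ℝ ∞ (fun u => f (u, p.2) - ψ p.2) p.1 :=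
      (ContDiffAt.comp (g := f) p.1 (hf.contDiffAt (hU.mem_nhds hp))
        (contDiffAt_id.prodMk contDiffAt_const)).sub contDiffAt_const
    have hc : ContinuousAt (fun u : ℝ => (u, p.2)) p.1 := by fun_prop
    refine h1.congr_of_eventuallyEq ?_
    filter_upwards [hc.preimage_mem_nhds (hU.mem_nhds hp)] with u hu
    simp [h _ hu]
  · have h1 : ContDiffAt ℝ ∞ (fun v => f (p.1, v) - φ p.1) p.2 :=
      (ContDiffAt.comp (g := f) p.2 (hf.contDiffAt (hU.mem_nhds hp))
        (contDiffAt_const.prodMk contDiffAt_id)).sub contDiffAt_const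
    have hc : ContinuousAt (fun v : ℝ => (p.1, v)) p.2 := by fun_prop
    refine h1.congr_of_eventuallyEq ?_
    filter_upwards [hc.preimage_mem_nhds (hU.mem_nhds hp)] with v hv
    simp [h _ hv]

/-- A smooth function on an open interval with vanishing second derivative is affine. -/
theorem exists_affine_of_deriv_deriv_eq_zero {I : Set ℝ} (hI : IsOpen I) (hIc : IsPreconnected I)
    {φ : ℝ → ℝ} (hφ : ∀ u ∈ I, ContDiffAt ℝ ∞ φ u) (h0 : ∀ u ∈ I, deriv (deriv φ) u = 0) :
    ∃ α β : ℝ, ∀ u ∈ I, φ u = α * u + β := by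
  obtain ⟨α, hα⟩ := hI.exists_is_const_of_deriv_eq_zero hIc (f := deriv φ)
    (fun u hu => (hφ u hu).deriv_infty.hasDerivAt_deriv.differentiableAt.differentiableWithinAt)
    h0
  obtain ⟨β, hβ⟩ := hI.exists_eq_add_of_deriv_eq hIc (f := φ) (g := fun u => α * u)
    (fun u hu => (hφ u hu).hasDerivAt_deriv.differentiableAt.differentiableWithinAt)
    (by fun_prop) (fun u hu => by simp [hα u hu])
  exact ⟨α, β, hβ⟩

/-! ### Hyperbola branches and their differential equation -/

/-- The branch of the hyperbola `y ^ 2 - (u - u₀) ^ 2 = a ^ 2` on which `y` has the sign of `a`. -/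
noncomputable def branch (a u₀ u : ℝ) : ℝ := a * Real.sqrt (1 + ((u - u₀) / a) ^ 2)

theorem branch_neg (a u₀ u : ℝ) : branch (-a) u₀ u = -branch a u₀ u := by
  simp [branch, div_neg]

theorem branch_of_pos {a : ℝ} (ha : 0 < a) (u₀ u : ℝ) :
    branch a u₀ u = Real.sqrt (a ^ 2 + (u - u₀) ^ 2) := by
  have h : a ^ 2 + (u - u₀) ^ 2 = a ^ 2 * (1 + ((u - u₀) / a) ^ 2) := by
    have := ha.ne'
    field_simp
  rw [branch, h, Real.sqrt_mul (sq_nonneg a), Real.sqrt_sq ha.le]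

theorem branch_abs {a : ℝ} (ha : a ≠ 0) (u₀ u : ℝ) :
    branch |a| u₀ u = Real.sqrt (a ^ 2 + (u - u₀) ^ 2) := by
  rw [branch_of_pos (abs_pos.2 ha), sq_abs]

theorem branch_of_neg {a : ℝ} (ha : a < 0) (u₀ u : ℝ) :
    branch a u₀ u = -Real.sqrt (a ^ 2 + (u - u₀) ^ 2) := by
  rw [← branch_abs ha.ne, abs_of_neg ha, branch_neg, neg_neg]

theorem branch_add_mul_sinh {a : ℝ} (ha : a ≠ 0) (u₀ s : ℝ) :
    branch a u₀ (u₀ + a * Real.sinh s) = a * Real.cosh s := by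
  have h : (u₀ + a * Real.sinh s - u₀) / a = Real.sinh s := by
    field_simp
    ring
  rw [branch, h, add_comm, ← Real.cosh_sq, Real.sqrt_sq (Real.cosh_pos s).le]

theorem hasDerivAt_branch {a : ℝ} (ha : a ≠ 0) (u₀ u : ℝ) :
    HasDerivAt (branch a u₀) ((u - u₀) / a / Real.sqrt (1 + ((u - u₀) / a) ^ 2)) u := by
  have h0 : 0 < 1 + ((u - u₀) / a) ^ 2 := by positivity
  have h1 := (((((hasDerivAt_id' u).sub_const u₀).div_const a).fun_pow 2).const_add 1).sqrt h0.ne'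
  refine (h1.const_mul a).congr_deriv ?_
  have h2 := (Real.sqrt_pos.2 h0).ne'
  field_simp
  norm_num
  field_simp

theorem deriv_branch {a : ℝ} (ha : a ≠ 0) (u₀ : ℝ) :
    deriv (branch a u₀) = fun u => (u - u₀) / a / Real.sqrt (1 + ((u - u₀) / a) ^ 2) :=
  funext fun u => (hasDerivAt_branch ha u₀ u).deriv

theorem deriv_deriv_branch {a : ℝ} (ha : a ≠ 0) (u₀ u : ℝ) :
    deriv (deriv (branch a u₀)) u = 1 / (a * Real.sqrt (1 + ((u - u₀) / a) ^ 2) ^ 3) := by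
  have h0 : 0 < 1 + ((u - u₀) / a) ^ 2 := by positivity
  have h2 := (Real.sqrt_pos.2 h0).ne'
  have h3 := ((hasDerivAt_id' u).sub_const u₀).div_const a
  have h1 := h3.fun_div (((h3.fun_pow 2).const_add 1).sqrt h0.ne') h2
  rw [deriv_branch ha, h1.deriv]
  have h4 := Real.sq_sqrt h0.le
  set y := Real.sqrt (1 + ((u - u₀) / a) ^ 2)
  set x := (u - u₀) / a
  norm_num
  field_simp
  linear_combination h4

theorem contDiff_branch (a u₀ : ℝ) : ContDiff ℝ ∞ (branch a u₀) := by
  unfold branch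
  refine contDiff_const.mul (ContDiff.sqrt (by fun_prop) fun u => ?_)
  positivity

/-- The solutions of `g g'' + g' ^ 2 = 1` with `g' ^ 2 < 1` on an open interval. -/
theorem eq_branch_of_ode {I : Set ℝ} (hI : IsOpen I) (hIc : IsConnected I) {g : ℝ → ℝ}
    (hg : ∀ u ∈ I, ContDiffAt ℝ ∞ g u) (hlt : ∀ u ∈ I, deriv g u ^ 2 < 1)
    (hode : ∀ u ∈ I, g u * deriv (deriv g) u + deriv g u ^ 2 = 1) :
    ∃ a u₀ : ℝ, a ≠ 0 ∧ ∀ u ∈ I, g u = branch a u₀ u := by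
  have hd : ∀ u ∈ I, HasDerivAt g (deriv g u) u := fun u hu => (hg u hu).hasDerivAt_deriv
  -- The equation says `(g g')' = 1`; two integrations give `g² = (u + k)² + A`.
  have hdd : ∀ u ∈ I, HasDerivAt (fun t => g t * deriv g t) 1 u := fun u hu => by
    have h := (hd u hu).mul (hg u hu).deriv_infty.hasDerivAt_deriv
    have e : deriv g u * deriv g u + g u * deriv (deriv g) u = 1 := by
      rw [← hode u hu]; ring
    rw [e] at h
    exact h
  obtain ⟨k, hk⟩ := hI.exists_eq_add_of_deriv_eq hIc.isPreconnected
    (f := fun t => g t * deriv g t) (g := fun t => t)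
    (fun u hu => (hdd u hu).differentiableAt.differentiableWithinAt)
    (by fun_prop) (fun u hu => by simp [(hdd u hu).deriv])
  have hsqd : ∀ u ∈ I, HasDerivAt (fun t => g t ^ 2) (2 * (u + k)) u := fun u hu => by
    have h := (hd u hu).pow 2
    have e : ((2 : ℕ) : ℝ) * g u ^ (2 - 1) * deriv g u = 2 * (u + k) := by
      have e0 : g u * deriv g u = u + k := hk hu
      rw [← e0]
      norm_num
      ring
    rw [e] at h
    exact h
  have hsqd' : ∀ u, HasDerivAt (fun t : ℝ => (t + k) ^ 2) (2 * (u + k)) u := fun u => by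
    have h := ((hasDerivAt_id' u).add_const k).fun_pow 2
    simpa using h
  obtain ⟨A, hA⟩ := hI.exists_eq_add_of_deriv_eq hIc.isPreconnected
    (f := fun t => g t ^ 2) (g := fun t => (t + k) ^ 2)
    (fun u hu => (hsqd u hu).differentiableAt.differentiableWithinAt)
    (by fun_prop) (fun u hu => by rw [(hsqd u hu).deriv, (hsqd' u).deriv])
  -- `A = g² (1 - g'²)`, and the equation with `g'² < 1` excludes `g = 0`.
  have hApos : 0 < A := by
    obtain ⟨u, hu⟩ := hIc.nonempty
    have h1 := hode u hu
    have h2 := hlt u hu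
    have h3 : g u * deriv g u = u + k := hk hu
    have h4 : g u ^ 2 = (u + k) ^ 2 + A := hA hu
    have h5 : g u ≠ 0 := by
      intro h
      rw [h] at h1
      linarith
    have h6 : A = g u ^ 2 * (1 - deriv g u ^ 2) := by
      rw [← h3] at h4
      linarith
    rw [h6]
    exact mul_pos (by positivity) (by linarith)
  have hsA := Real.sqrt_pos.2 hApos
  have hp : ∀ u : ℝ, 0 < Real.sqrt A ^ 2 + (u - -k) ^ 2 := fun u => by positivity
  -- The branch never vanishes, so `g` keeps one sign on the connected set `I`.
  have h := hIc.isPreconnected.eq_or_eq_neg_of_sq_eq (f := g) (g := branch (Real.sqrt A) (-k))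
    (fun u hu => (hg u hu).continuousAt.continuousWithinAt)
    (contDiff_branch _ _).continuous.continuousOn
    (fun u hu => by
      have h4 : g u ^ 2 = (u + k) ^ 2 + A := hA hu
      simp only [Pi.pow_apply]
      rw [branch_of_pos hsA, Real.sq_sqrt (hp u).le, Real.sq_sqrt hApos.le, h4]
      ring)
    (fun {u} _ => by
      rw [branch_of_pos hsA]
      exact (Real.sqrt_pos.2 (hp u)).ne')
  rcases h with h | h
  · exact ⟨Real.sqrt A, -k, hsA.ne', fun u hu => h hu⟩
  · exact ⟨-Real.sqrt A, -k, neg_ne_zero.2 hsA.ne', fun u hu => by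
      rw [h hu, branch_neg, Pi.neg_apply]⟩

/-! ### From conformality to hyperbola branches -/

namespace IsSmoothSum

variable {f : ℝ × ℝ → ℝ} {U : Set (ℝ × ℝ)} {φ ψ : ℝ → ℝ}

/-- For the graph of `f = φ(u) + ψ(v)`, the matrix of `IV` at `p` is `σ` times that of `II`, up to
the positive factors that the two matrices carry. -/
def PointwiseConformal (f : ℝ × ℝ → ℝ) (φ ψ : ℝ → ℝ) (p : ℝ × ℝ) (σ : ℝ) : Prop :=
  deriv (deriv φ) p.1 ^ 2 * (1 - deriv ψ p.2 ^ 2) =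
      σ * (f p * deriv (deriv φ) p.1 - 1 + deriv φ p.1 ^ 2) ∧
    deriv (deriv φ) p.1 * deriv (deriv ψ) p.2 * (deriv φ p.1 * deriv ψ p.2) =
      σ * (deriv φ p.1 * deriv ψ p.2) ∧
    deriv (deriv ψ) p.2 ^ 2 * (1 - deriv φ p.1 ^ 2) =
      σ * (f p * deriv (deriv ψ) p.2 - 1 + deriv ψ p.2 ^ 2)

theorem exists_pointwiseConformal (h : IsSmoothSum f U φ ψ) (hU : IsOpen U)
    (hpos : ∀ q ∈ U, 0 < f q) (hlt : ∀ q ∈ U, deriv φ q.1 ^ 2 + deriv ψ q.2 ^ 2 < 1)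
    (hc : HasConformalNormalGaussMap (graphSurface f) U) {p : ℝ × ℝ} (hp : p ∈ U) :
    ∃ σ, PointwiseConformal f φ ψ p σ := by
  obtain ⟨N, hN, ρ, -, hρ⟩ := hc
  have hW : 1 - deriv φ p.1 ^ 2 - deriv ψ p.2 ^ 2 ≠ 0 := by linarith [hlt p hp]
  -- `ρ` corrected by the scalar factors of II and IV; the three equations are the entries on the
  -- standard basis.
  refine ⟨ρ p * (N p 2 / f p ^ 3) * (1 - deriv φ p.1 ^ 2 - deriv ψ p.2 ^ 2) ^ 2, ?_, ?_, ?_⟩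
  · have h1 := hρ p hp (1, 0) (1, 0)
    rw [h.fourthForm_eq hU hpos hp hN, h.secondForm_eq hU hp (hpos p hp) hN,
      div_eq_iff (pow_ne_zero 2 hW)] at h1
    simp at h1
    rw [h1]
    ring
  · have h1 := hρ p hp (1, 0) (0, 1)
    rw [h.fourthForm_eq hU hpos hp hN, h.secondForm_eq hU hp (hpos p hp) hN,
      div_eq_iff (pow_ne_zero 2 hW)] at h1
    simp at h1
    rw [h1]
    ring
  · have h1 := hρ p hp (0, 1) (0, 1)
    rw [h.fourthForm_eq hU hpos hp hN, h.secondForm_eq hU hp (hpos p hp) hN,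
      div_eq_iff (pow_ne_zero 2 hW)] at h1
    simp at h1
    rw [h1]
    ring

/-- The differential equation of the translational surfaces with conformal normal Gauss map. -/
theorem conformal_equation (h : IsSmoothSum f U φ ψ) (hU : IsOpen U)
    (hlt : ∀ q ∈ U, deriv φ q.1 ^ 2 + deriv ψ q.2 ^ 2 < 1)
    (hc : ∀ q ∈ U, ∃ σ, PointwiseConformal f φ ψ q σ) {p : ℝ × ℝ} (hp : p ∈ U) :
    deriv (deriv φ) p.1 * (1 - deriv ψ p.2 ^ 2) + deriv (deriv ψ) p.2 * (1 - deriv φ p.1 ^ 2) =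
      f p * deriv (deriv φ) p.1 * deriv (deriv ψ) p.2 := by
  set F : ℝ × ℝ → ℝ := fun p => deriv (deriv φ) p.1 * (1 - deriv ψ p.2 ^ 2) +
    deriv (deriv ψ) p.2 * (1 - deriv φ p.1 ^ 2) -
      f p * deriv (deriv φ) p.1 * deriv (deriv ψ) p.2 with hF
  have hgen : ∀ q ∈ U, deriv φ q.1 * deriv ψ q.2 ≠ 0 → F q = 0 := by
    intro q hq hne
    obtain ⟨σ, h1, h2, h3⟩ := hc q hq
    have hσ := (mul_right_cancel₀ hne h2).symm
    rw [hσ] at h1 h3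
    have hl := hlt q hq
    by_cases hr : deriv (deriv φ) q.1 = 0
    · have h4 : deriv (deriv ψ) q.2 = 0 := by
        rw [hr] at h3
        have h5 : (1 - deriv φ q.1 ^ 2) ≠ 0 := by nlinarith [sq_nonneg (deriv ψ q.2)]
        simpa [h5] using h3
      simp [hF, hr, h4]
    · have h4 : deriv (deriv φ) q.1 * F q = 0 := by
        simp only [hF]
        linear_combination h1
      exact (mul_eq_zero.1 h4).resolve_left hr
  by_contra hne
  have hne' : F p ≠ 0 := fun h0 => hne (sub_eq_zero.1 h0)
  have hFc : ContinuousAt F p := by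
    have e1 : ContinuousAt (fun q : ℝ × ℝ => deriv φ q.1) p :=
      ContinuousAt.comp (g := deriv φ) (h.left p hp).deriv_infty.continuousAt continuousAt_fst
    have e2 : ContinuousAt (fun q : ℝ × ℝ => deriv ψ q.2) p :=
      ContinuousAt.comp (g := deriv ψ) (h.right p hp).deriv_infty.continuousAt continuousAt_snd
    have e3 : ContinuousAt (fun q : ℝ × ℝ => deriv (deriv φ) q.1) p :=
      ContinuousAt.comp (g := deriv (deriv φ))
        (h.left p hp).deriv_infty.deriv_infty.continuousAt continuousAt_fst
    have e4 : ContinuousAt (fun q : ℝ × ℝ => deriv (deriv ψ) q.2) p :=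
      ContinuousAt.comp (g := deriv (deriv ψ))
        (h.right p hp).deriv_infty.deriv_infty.continuousAt continuousAt_snd
    have e5 : ContinuousAt f p := (h.hasFDerivAt hU hp).continuousAt
    fun_prop
  -- If `F p ≠ 0`, then `φ' ψ'` vanishes on a product neighbourhood, so one factor vanishes
  -- identically near its coordinate. The ratio at `p` is then `0`, which kills both second
  -- derivatives and hence `F p`.
  have hev : ∀ᶠ q in nhds p, deriv φ q.1 * deriv ψ q.2 = 0 := by
    filter_upwards [hFc.eventually_ne hne', hU.mem_nhds hp] with q h1 h2
    by_contra h3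
    exact h1 (hgen q h2 h3)
  rw [← Prod.mk.eta (p := p), nhds_prod_eq, Filter.eventually_prod_iff] at hev
  obtain ⟨pa, ha, pb, hb, hab⟩ := hev
  obtain ⟨σ, h1, h2, h3⟩ := hc p hp
  have hl := hlt p hp
  apply hne'
  by_cases hz : ∀ u, pa u → deriv φ u = 0
  · have e1 : deriv φ =ᶠ[nhds p.1] fun _ => 0 := by
      filter_upwards [ha] with u hu using hz u hu
    have e2 : deriv φ p.1 = 0 := e1.eq_of_nhds
    have e3 : deriv (deriv φ) p.1 = 0 := by simp [e1.deriv_eq]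
    have e4 : σ = 0 := by simpa [e2, e3] using h1
    have e5 : deriv (deriv ψ) p.2 = 0 := by simpa [e2, e4] using h3
    simp [hF, e3, e5]
  · push Not at hz
    obtain ⟨u, hu, hune⟩ := hz
    have e1 : deriv ψ =ᶠ[nhds p.2] fun _ => 0 := by
      filter_upwards [hb] with v hv
      exact (mul_eq_zero.1 (hab hu hv)).resolve_left hune
    have e2 : deriv ψ p.2 = 0 := e1.eq_of_nhds
    have e3 : deriv (deriv ψ) p.2 = 0 := by simp [e1.deriv_eq]
    have e4 : σ = 0 := by simpa [e2, e3] using h3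
    have e5 : deriv (deriv φ) p.1 = 0 := by simpa [e2, e4] using h1
    simp [hF, e3, e5]

end IsSmoothSum

/-- Two relations, each tied to one of the two coordinates, that agree on a connected open set of
the plane are constant. -/
theorem apply_fst_eq_of_apply_fst_eq_apply_snd {α : Type*} {U : Set (ℝ × ℝ)} (hU : IsOpen U)
    (hUc : IsPreconnected U) {A B : ℝ → α} (h : ∀ p ∈ U, A p.1 = B p.2) {p q : ℝ × ℝ}
    (hp : p ∈ U) (hq : q ∈ U) : A p.1 = A q.1 := by
  refine hUc.induction₂ (fun x y => A x.1 = A y.1) (fun x hx => ?_)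
    (fun x y z _ _ _ h1 h2 => h1.trans h2) (fun x y _ _ h1 => h1.symm) hp hq
  -- For `y` near `x` the corner `(y.1, x.2)` lies in `U` and links the two values. Slices of `U`
  -- may be disconnected, so only this local step is available before connectedness of `U` is
  -- invoked.
  have hc : ContinuousAt (fun y : ℝ × ℝ => (y.1, x.2)) x := by fun_prop
  filter_upwards [mem_nhdsWithin_of_mem_nhds (hc.preimage_mem_nhds (hU.mem_nhds hx))] with y hy
  rw [h x hx, ← h _ hy]

namespace IsSmoothSum

variable {f : ℝ × ℝ → ℝ} {U : Set (ℝ × ℝ)} {φ ψ : ℝ → ℝ}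

theorem eq_branch_add_branch (h : IsSmoothSum f U φ ψ) (hU : IsOpen U) (hUc : IsConnected U)
    (hlt : ∀ q ∈ U, deriv φ q.1 ^ 2 + deriv ψ q.2 ^ 2 < 1)
    (heq : ∀ p ∈ U, deriv (deriv φ) p.1 * (1 - deriv ψ p.2 ^ 2) +
      deriv (deriv ψ) p.2 * (1 - deriv φ p.1 ^ 2) =
        f p * deriv (deriv φ) p.1 * deriv (deriv ψ) p.2) (hpl : ¬ IsPlanar f U) :
    ∃ a b u₀ v₀ : ℝ, a ≠ 0 ∧ b ≠ 0 ∧ ∀ p ∈ U, f p = branch a u₀ p.1 + branch b v₀ p.2 := by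
  have hI : IsOpen (Prod.fst '' U) := isOpenMap_fst U hU
  have hJ : IsOpen (Prod.snd '' U) := isOpenMap_snd U hU
  have hIc : IsConnected (Prod.fst '' U) := hUc.image _ continuous_fst.continuousOn
  have hJc : IsConnected (Prod.snd '' U) := hUc.image _ continuous_snd.continuousOn
  have hφ : ∀ u ∈ Prod.fst '' U, ContDiffAt ℝ ∞ φ u := by
    rintro _ ⟨p, hp, rfl⟩
    exact h.left p hp
  have hψ : ∀ v ∈ Prod.snd '' U, ContDiffAt ℝ ∞ ψ v := by
    rintro _ ⟨p, hp, rfl⟩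
    exact h.right p hp
  have hP : ∀ p ∈ U, 0 < 1 - deriv φ p.1 ^ 2 := fun p hp => by
    nlinarith [hlt p hp, sq_nonneg (deriv ψ p.2)]
  have hQ : ∀ p ∈ U, 0 < 1 - deriv ψ p.2 ^ 2 := fun p hp => by
    nlinarith [hlt p hp, sq_nonneg (deriv φ p.1)]
  have hiff : ∀ p ∈ U, (deriv (deriv φ) p.1 = 0) = (deriv (deriv ψ) p.2 = 0) := fun p hp => by
    have h1 := heq p hp
    refine propext ⟨fun h0 => ?_, fun h0 => ?_⟩
    · simpa [h0, (hP p hp).ne'] using h1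
    · simpa [h0, (hQ p hp).ne'] using h1
  -- The separation lemma is applied to proposition-valued functions.
  have hconst : ∀ p ∈ U, ∀ q ∈ U, (deriv (deriv φ) p.1 = 0) = (deriv (deriv φ) q.1 = 0) :=
    fun p hp q hq => apply_fst_eq_of_apply_fst_eq_apply_snd hU hUc.isPreconnected
      (A := fun u => deriv (deriv φ) u = 0) (B := fun v => deriv (deriv ψ) v = 0) hiff hp hq
  have hr : ∀ p ∈ U, deriv (deriv φ) p.1 ≠ 0 := by
    intro p hp h0
    have h1 : ∀ q ∈ U, deriv (deriv φ) q.1 = 0 := fun q hq => hconst p hp q hq ▸ h0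
    have h2 : ∀ q ∈ U, deriv (deriv ψ) q.2 = 0 := fun q hq => hiff q hq ▸ h1 q hq
    obtain ⟨α, γ, h3⟩ := exists_affine_of_deriv_deriv_eq_zero hI hIc.isPreconnected hφ (by
      rintro _ ⟨q, hq, rfl⟩
      exact h1 q hq)
    obtain ⟨β, γ', h4⟩ := exists_affine_of_deriv_deriv_eq_zero hJ hJc.isPreconnected hψ (by
      rintro _ ⟨q, hq, rfl⟩
      exact h2 q hq)
    refine hpl ⟨α, β, γ + γ', fun q hq => ?_⟩
    rw [h.eq q hq, h3 _ ⟨q, hq, rfl⟩, h4 _ ⟨q, hq, rfl⟩]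
    ring
  have hs : ∀ p ∈ U, deriv (deriv ψ) p.2 ≠ 0 := fun p hp h0 => hr p hp ((hiff p hp).symm ▸ h0)
  -- Division by `φ'' ψ''` separates the variables; the common constant `c` shifts `φ` to `φ + c`
  -- and `ψ` to `ψ - c`.
  have hAB : ∀ p ∈ U, (1 - deriv φ p.1 ^ 2) / deriv (deriv φ) p.1 - φ p.1 =
      ψ p.2 - (1 - deriv ψ p.2 ^ 2) / deriv (deriv ψ) p.2 := fun p hp => by
    have h1 := heq p hp
    have h2 := hr p hp
    have h3 := hs p hp
    rw [h.eq p hp] at h1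
    field_simp
    linarith
  obtain ⟨p₀, hp₀⟩ := hUc.nonempty
  obtain ⟨c, hc⟩ : ∃ c, ∀ p ∈ U, (1 - deriv φ p.1 ^ 2) / deriv (deriv φ) p.1 - φ p.1 = c :=
    ⟨_, fun p hp => apply_fst_eq_of_apply_fst_eq_apply_snd hU hUc.isPreconnected
      (A := fun u => (1 - deriv φ u ^ 2) / deriv (deriv φ) u - φ u)
      (B := fun v => ψ v - (1 - deriv ψ v ^ 2) / deriv (deriv ψ) v) hAB hp hp₀⟩
  have hdφ : deriv (fun u => φ u + c) = deriv φ := by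
    ext u
    simp
  have hdψ : deriv (fun v => ψ v + -c) = deriv ψ := by
    ext v
    simp
  obtain ⟨a, u₀, ha, hg⟩ := eq_branch_of_ode hI hIc (g := fun u => φ u + c)
    (fun u hu => (hφ u hu).add contDiffAt_const)
    (by
      rintro _ ⟨p, hp, rfl⟩
      rw [hdφ]
      linarith [hP p hp])
    (by
      rintro _ ⟨p, hp, rfl⟩
      have h1 := hc p hp
      have h2 := hr p hp
      simp only [hdφ]
      rw [← h1]
      field_simp
      ring)
  obtain ⟨b, v₀, hb, hk⟩ := eq_branch_of_ode hJ hJc (g := fun v => ψ v + -c)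
    (fun v hv => (hψ v hv).add contDiffAt_const)
    (by
      rintro _ ⟨p, hp, rfl⟩
      rw [hdψ]
      linarith [hQ p hp])
    (by
      rintro _ ⟨p, hp, rfl⟩
      have h1 := (hAB p hp).symm.trans (hc p hp)
      have h2 := hs p hp
      simp only [hdψ]
      rw [← h1]
      field_simp
      ring)
  refine ⟨a, b, u₀, v₀, ha, hb, fun p hp => ?_⟩
  rw [← hg _ ⟨p, hp, rfl⟩, ← hk _ ⟨p, hp, rfl⟩, h.eq p hp]
  ring

end IsSmoothSum

/-! ### Space-likeness, non-planarity and the converse -/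

namespace IsSmoothSum

variable {f : ℝ × ℝ → ℝ} {U : Set (ℝ × ℝ)} {φ ψ : ℝ → ℝ}

theorem isSpacelike_iff (h : IsSmoothSum f U φ ψ) (hU : IsOpen U) (hpos : ∀ q ∈ U, 0 < f q) :
    IsSpacelike (graphSurface f) U ↔ ∀ p ∈ U, deriv φ p.1 ^ 2 + deriv ψ p.2 ^ 2 < 1 := by
  refine forall₂_congr fun p hp => ?_
  have hf : 0 < f p ^ 2 := pow_pos (hpos p hp) 2
  simp_rw [h.metric_tangent hU hp, div_pos_iff_of_pos_right hf]
  set P := deriv φ p.1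
  set Q := deriv ψ p.2
  constructor
  · intro h1
    by_cases h0 : (P, Q) = ((0, 0) : ℝ × ℝ)
    · simp only [Prod.mk.injEq] at h0
      simp [h0.1, h0.2]
    · have h2 := h1 (P, Q) h0
      simp only at h2
      by_contra h3
      nlinarith
  · intro h1 w hw
    have h2 : 0 < w.1 ^ 2 + w.2 ^ 2 := by
      by_cases h3 : w.1 = 0
      · have h4 : w.2 ≠ 0 := fun h4 => hw (Prod.ext h3 h4)
        positivity
      · positivity
    nlinarith [sq_nonneg (P * w.2 - Q * w.1)]

/-- A plane is itself a smooth sum; both decompositions compute the same second derivative of the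
graph. -/
theorem not_isPlanar (h : IsSmoothSum f U φ ψ) (hU : IsOpen U) {p : ℝ × ℝ} (hp : p ∈ U)
    (h0 : deriv (deriv φ) p.1 ≠ 0) : ¬ IsPlanar f U := by
  rintro ⟨α, β, γ, hpl⟩
  have h' : IsSmoothSum f U (fun u => α * u + γ) (fun v => β * v) := by
    refine ⟨fun q hq => ?_, fun q _ => by fun_prop, fun q _ => by fun_prop⟩
    rw [hpl q hq]
    ring
  have h1 := h.fderiv_tangent hU hp (1, 0) (1, 0)
  rw [h'.fderiv_tangent hU hp] at h1
  have h2 := congrFun h1 2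
  have h3 : deriv (fun u : ℝ => α * u + γ) = fun _ => α := by
    ext u
    simp
  rw [h3] at h2
  simp at h2
  exact h0 h2.symm

theorem hasConformalNormalGaussMap (h : IsSmoothSum f U φ ψ) (hU : IsOpen U)
    (hpos : ∀ q ∈ U, 0 < f q) (hlt : ∀ q ∈ U, deriv φ q.1 ^ 2 + deriv ψ q.2 ^ 2 < 1)
    (heq : ∀ p ∈ U, deriv (deriv φ) p.1 * (1 - deriv ψ p.2 ^ 2) +
      deriv (deriv ψ) p.2 * (1 - deriv φ p.1 ^ 2) =
        f p * deriv (deriv φ) p.1 * deriv (deriv ψ) p.2) :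
    HasConformalNormalGaussMap (graphSurface f) U := by
  have hφ1 : ContDiffOn ℝ ∞ (fun q : ℝ × ℝ => deriv φ q.1) U := fun q hq =>
    (ContDiffAt.comp (g := deriv φ) q (h.left q hq).deriv_infty contDiffAt_fst).contDiffWithinAt
  have hψ1 : ContDiffOn ℝ ∞ (fun q : ℝ × ℝ => deriv ψ q.2) U := fun q hq =>
    (ContDiffAt.comp (g := deriv ψ) q (h.right q hq).deriv_infty contDiffAt_snd).contDiffWithinAt
  have hφ2 : ContDiffOn ℝ ∞ (fun q : ℝ × ℝ => deriv (deriv φ) q.1) U := fun q hq =>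
    (ContDiffAt.comp (g := deriv (deriv φ)) q (h.left q hq).deriv_infty.deriv_infty
      contDiffAt_fst).contDiffWithinAt
  have hψ2 : ContDiffOn ℝ ∞ (fun q : ℝ × ℝ => deriv (deriv ψ) q.2) U := fun q hq =>
    (ContDiffAt.comp (g := deriv (deriv ψ)) q (h.right q hq).deriv_infty.deriv_infty
      contDiffAt_snd).contDiffWithinAt
  have hf : ContDiffOn ℝ ∞ f U := by
    refine ContDiffOn.congr (f := fun q : ℝ × ℝ => φ q.1 + ψ q.2) (fun q hq => ?_) h.eq
    exact ((ContDiffAt.comp (g := φ) q (h.left q hq) contDiffAt_fst).add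
      (ContDiffAt.comp (g := ψ) q (h.right q hq) contDiffAt_snd)).contDiffWithinAt
  set W : ℝ × ℝ → ℝ := fun q => 1 - deriv φ q.1 ^ 2 - deriv ψ q.2 ^ 2 with hWdef
  have hWpos : ∀ q ∈ U, 0 < W q := fun q hq => by
    have := hlt q hq
    simp only [hWdef]
    linarith
  have hW : ContDiffOn ℝ ∞ W U := (contDiffOn_const.sub (hφ1.pow 2)).sub (hψ1.pow 2)
  have hsW : ContDiffOn ℝ ∞ (fun q => Real.sqrt (W q)) U := hW.sqrt fun q hq => (hWpos q hq).ne'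
  have hl : ContDiffOn ℝ ∞ (fun q => f q / Real.sqrt (W q)) U :=
    hf.div hsW fun q hq => (Real.sqrt_pos.2 (hWpos q hq)).ne'
  have hN : IsUnitNormal (graphSurface f)
      (fun q => (f q / Real.sqrt (W q)) • ![deriv φ q.1, deriv ψ q.2, 1]) U := by
    refine ⟨hl.smul ?_, fun p hp => ⟨?_, fun w => ?_⟩⟩
    · rw [contDiffOn_pi]
      intro i
      fin_cases i
      · exact hφ1
      · exact hψ1
      · exact contDiffOn_const
    · have h1 := Real.sq_sqrt (hWpos p hp).le
      have h2 := (Real.sqrt_pos.2 (hWpos p hp)).ne'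
      have h3 := (hpos p hp).ne'
      simp [metric, minkowski, graphSurface]
      field_simp
      rw [h1]
      simp only [hWdef]
      ring
    · rw [h.tangent_graphSurface hU hp]
      simp [metric, minkowski, graphSurface]
      left
      ring
  -- Here II carries the factor `1 / (f² √W)` and IV the factor `1 / W²`, so this is the `ρ` for the
  -- ratio `φ'' ψ''`.
  refine ⟨_, hN, fun q => deriv (deriv φ) q.1 * deriv (deriv ψ) q.2 * f q ^ 2 *
    Real.sqrt (W q) / W q ^ 2, ?_, fun p hp w z => ?_⟩
  · exact (((hφ2.mul hψ2).mul (hf.pow 2)).mul hsW).div (hW.pow 2)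
      fun q hq => pow_ne_zero 2 (hWpos q hq).ne'
  · rw [h.fourthForm_eq hU hpos hp hN, h.secondForm_eq hU hp (hpos p hp) hN]
    have h2 := (Real.sqrt_pos.2 (hWpos p hp)).ne'
    have h3 := (hpos p hp).ne'
    have h4 := (hWpos p hp).ne'
    have h5 := heq p hp
    change _ / W p ^ 2 = _
    simp
    field_simp
    linear_combination (deriv (deriv φ) p.1 * w.1 * z.1 + deriv (deriv ψ) p.2 * w.2 * z.2) * h5

end IsSmoothSum

theorem isSmoothSum_branch {f : ℝ × ℝ → ℝ} {U : Set (ℝ × ℝ)} {a b u₀ v₀ : ℝ}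
    (h : ∀ p ∈ U, f p = branch a u₀ p.1 + branch b v₀ p.2) :
    IsSmoothSum f U (branch a u₀) (branch b v₀) :=
  ⟨h, fun _ _ => (contDiff_branch _ _).contDiffAt, fun _ _ => (contDiff_branch _ _).contDiffAt⟩

/-- With `A`, `B` the two square roots, `φ = a A`, `1 - φ'² = 1 / A²` and `φ'' = 1 / (a A³)`, and
similarly for `ψ`; both sides are `(a A + b B) / (a b A³ B³)`. -/
theorem branch_conformal_equation {a b : ℝ} (ha : a ≠ 0) (hb : b ≠ 0) (u₀ v₀ u v : ℝ) :
    deriv (deriv (branch a u₀)) u * (1 - deriv (branch b v₀) v ^ 2) +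
      deriv (deriv (branch b v₀)) v * (1 - deriv (branch a u₀) u ^ 2) =
        (branch a u₀ u + branch b v₀ v) * deriv (deriv (branch a u₀)) u *
          deriv (deriv (branch b v₀)) v := by
  rw [deriv_deriv_branch ha, deriv_deriv_branch hb, deriv_branch ha, deriv_branch hb, branch,
    branch]
  simp only
  have h1 : 0 < 1 + ((u - u₀) / a) ^ 2 := by positivity
  have h2 : 0 < 1 + ((v - v₀) / b) ^ 2 := by positivity
  have h3 := Real.sq_sqrt h1.le
  have h4 := Real.sq_sqrt h2.le
  have h5 := (Real.sqrt_pos.2 h1).ne'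
  have h6 := (Real.sqrt_pos.2 h2).ne'
  generalize Real.sqrt (1 + ((u - u₀) / a) ^ 2) = A at *
  generalize Real.sqrt (1 + ((v - v₀) / b) ^ 2) = B at *
  have h7 : 1 - ((u - u₀) / a / A) ^ 2 = 1 / A ^ 2 := by
    rw [div_pow _ A, ← sub_eq_of_eq_add' h3]
    field_simp
    ring
  have h8 : 1 - ((v - v₀) / b / B) ^ 2 = 1 / B ^ 2 := by
    rw [div_pow _ B, ← sub_eq_of_eq_add' h4]
    field_simp
    ring
  rw [h7, h8]
  field_simp
  ring

/-! ### The hyperbolic parametrization -/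

section Parametrization

variable {a b u₀ v₀ : ℝ}

/-- The projection of `sinhCoshSurface` to the parameter plane of a graph. -/
noncomputable def sinhMap (a b u₀ v₀ : ℝ) (q : ℝ × ℝ) : ℝ × ℝ :=
  (u₀ + a * Real.sinh q.1, v₀ + b * Real.sinh q.2)

theorem sinhMap_injective (ha : a ≠ 0) (hb : b ≠ 0) : Function.Injective (sinhMap a b u₀ v₀) := by
  intro q q' h
  simpa [sinhMap, ha, hb, Prod.ext_iff] using h

theorem sinhMap_surjective (ha : a ≠ 0) (hb : b ≠ 0) :
    Function.Surjective (sinhMap a b u₀ v₀) := by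
  intro p
  refine ⟨(Real.arsinh ((p.1 - u₀) / a), Real.arsinh ((p.2 - v₀) / b)), ?_⟩
  ext
  · simp [sinhMap, Real.sinh_arsinh, mul_div_cancel₀ _ ha]
  · simp [sinhMap, Real.sinh_arsinh, mul_div_cancel₀ _ hb]

theorem continuous_sinhMap : Continuous (sinhMap a b u₀ v₀) := by
  unfold sinhMap
  fun_prop

theorem sinhCoshSurface_eq (ha : a ≠ 0) (hb : b ≠ 0) {f : ℝ × ℝ → ℝ} {q : ℝ × ℝ}
    (h : f (sinhMap a b u₀ v₀ q) =
      branch a u₀ (sinhMap a b u₀ v₀ q).1 + branch b v₀ (sinhMap a b u₀ v₀ q).2) :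
    sinhCoshSurface a b u₀ v₀ q = graphSurface f (sinhMap a b u₀ v₀ q) := by
  rw [graphSurface, h]
  simp only [sinhMap, branch_add_mul_sinh ha, branch_add_mul_sinh hb]
  rfl

theorem tangent_sinhCoshSurface (q w : ℝ × ℝ) :
    tangent (sinhCoshSurface a b u₀ v₀) q w = ![a * Real.cosh q.1 * w.1, b * Real.cosh q.2 * w.2,
      a * Real.sinh q.1 * w.1 + b * Real.sinh q.2 * w.2] := by
  have h1 : HasFDerivAt (sinhCoshSurface a b u₀ v₀) (ContinuousLinearMap.pi
      ![(a * Real.cosh q.1) • ContinuousLinearMap.fst ℝ ℝ ℝ,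
        (b * Real.cosh q.2) • ContinuousLinearMap.snd ℝ ℝ ℝ,
        (a * Real.sinh q.1) • ContinuousLinearMap.fst ℝ ℝ ℝ +
          (b * Real.sinh q.2) • ContinuousLinearMap.snd ℝ ℝ ℝ]) q := by
    rw [hasFDerivAt_pi]
    intro i
    fin_cases i
    · exact (((Real.hasDerivAt_sinh q.1).const_mul a).const_add u₀).comp_fst
    · exact (((Real.hasDerivAt_sinh q.2).const_mul b).const_add v₀).comp_snd
    · exact ((Real.hasDerivAt_cosh q.1).const_mul a).comp_fst.add
        ((Real.hasDerivAt_cosh q.2).const_mul b).comp_snd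
  rw [tangent, h1.fderiv]
  ext i
  fin_cases i <;> simp

theorem deriv_branch_add_mul_sinh (ha : a ≠ 0) (s : ℝ) :
    deriv (branch a u₀) (u₀ + a * Real.sinh s) = Real.sinh s / Real.cosh s := by
  have h : (u₀ + a * Real.sinh s - u₀) / a = Real.sinh s := by
    field_simp
    ring
  rw [deriv_branch ha]
  simp only
  rw [h, add_comm, ← Real.cosh_sq, Real.sqrt_sq (Real.cosh_pos s).le]

variable {f : ℝ × ℝ → ℝ} {U : Set (ℝ × ℝ)}

theorem tangent_sinhCoshSurface_eq (ha : a ≠ 0) (hb : b ≠ 0) (hU : IsOpen U)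
    (h : ∀ p ∈ U, f p = branch a u₀ p.1 + branch b v₀ p.2) {q : ℝ × ℝ}
    (hq : sinhMap a b u₀ v₀ q ∈ U) (w : ℝ × ℝ) :
    tangent (sinhCoshSurface a b u₀ v₀) q w =
      tangent (graphSurface f) (sinhMap a b u₀ v₀ q)
        (a * Real.cosh q.1 * w.1, b * Real.cosh q.2 * w.2) := by
  rw [tangent_sinhCoshSurface, (isSmoothSum_branch h).tangent_graphSurface hU hq]
  simp only [sinhMap, deriv_branch_add_mul_sinh ha, deriv_branch_add_mul_sinh hb]
  have h1 := (Real.cosh_pos q.1).ne'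
  have h2 := (Real.cosh_pos q.2).ne'
  ext i
  fin_cases i <;> simp
  field_simp

theorem isSpacelike_sinhCoshSurface_iff (ha : a ≠ 0) (hb : b ≠ 0) (hU : IsOpen U)
    (h : ∀ p ∈ U, f p = branch a u₀ p.1 + branch b v₀ p.2) :
    IsSpacelike (sinhCoshSurface a b u₀ v₀) (sinhMap a b u₀ v₀ ⁻¹' U) ↔
      IsSpacelike (graphSurface f) U := by
  constructor
  · intro hs p hp w hw
    obtain ⟨q, rfl⟩ := sinhMap_surjective (u₀ := u₀) (v₀ := v₀) ha hb p
    have h1 := (Real.cosh_pos q.1).ne'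
    have h2 := (Real.cosh_pos q.2).ne'
    have h3 := hs q hp (w.1 / (a * Real.cosh q.1), w.2 / (b * Real.cosh q.2)) (by
      intro h0
      apply hw
      simpa [Prod.ext_iff, ha, hb, h1, h2] using h0)
    rw [tangent_sinhCoshSurface_eq ha hb hU h hp, sinhCoshSurface_eq ha hb (h _ hp)] at h3
    simpa only [mul_div_cancel₀ _ (mul_ne_zero ha h1), mul_div_cancel₀ _ (mul_ne_zero hb h2)]
      using h3
  · intro hs q hq w hw
    have h1 := (Real.cosh_pos q.1).ne'
    have h2 := (Real.cosh_pos q.2).ne'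
    rw [tangent_sinhCoshSurface_eq ha hb hU h hq, sinhCoshSurface_eq ha hb (h _ hq)]
    refine hs _ hq _ fun h0 => hw ?_
    simpa [Prod.ext_iff, ha, hb, h1, h2] using h0

/-- Since `sinhMap` is a bijection of the plane, the first two coordinates determine the parameter.
Thus `D` must be the preimage of `U`, and the surface is the graph reparametrized. -/
theorem exists_parametrization_iff (ha : a ≠ 0) (hb : b ≠ 0) (hU : IsOpen U) :
    (∃ D : Set (ℝ × ℝ), IsOpen D ∧ IsSpacelike (sinhCoshSurface a b u₀ v₀) D ∧
      Set.InjOn (sinhCoshSurface a b u₀ v₀) D ∧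
        sinhCoshSurface a b u₀ v₀ '' D = graphSurface f '' U) ↔
      IsSpacelike (graphSurface f) U ∧
        ∀ p ∈ U, f p = branch a u₀ p.1 + branch b v₀ p.2 := by
  constructor
  · rintro ⟨D, -, hs, -, him⟩
    have hfst : ∀ q p, sinhCoshSurface a b u₀ v₀ q = graphSurface f p →
        sinhMap a b u₀ v₀ q = p := fun q p hqp =>
      Prod.ext (congrFun hqp 0) (congrFun hqp 1)
    have h : ∀ p ∈ U, f p = branch a u₀ p.1 + branch b v₀ p.2 := by
      intro p hp
      obtain ⟨q, -, hqp⟩ := him.symm ▸ Set.mem_image_of_mem (graphSurface f) hp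
      have h1 : a * Real.cosh q.1 + b * Real.cosh q.2 = f p := congrFun hqp 2
      rw [← hfst q p hqp] at h1 ⊢
      rw [← h1]
      simp only [sinhMap, branch_add_mul_sinh ha, branch_add_mul_sinh hb]
    refine ⟨(isSpacelike_sinhCoshSurface_iff ha hb hU h).1 fun q hq => ?_, h⟩
    obtain ⟨q', hq', hqp⟩ :=
      him.symm ▸ Set.mem_image_of_mem (graphSurface f) (Set.mem_preimage.1 hq)
    exact sinhMap_injective ha hb (hfst q' _ hqp) ▸ hs q' hq'
  · rintro ⟨hs, h⟩
    refine ⟨sinhMap a b u₀ v₀ ⁻¹' U, hU.preimage continuous_sinhMap,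
      (isSpacelike_sinhCoshSurface_iff ha hb hU h).2 hs, fun q _ q' _ hqq => ?_, ?_⟩
    · exact sinhMap_injective ha hb (Prod.ext (congrFun hqq 0) (congrFun hqq 1))
    · ext y
      constructor
      · rintro ⟨q, hq, rfl⟩
        exact ⟨_, hq, (sinhCoshSurface_eq ha hb (h _ hq)).symm⟩
      · rintro ⟨p, hp, rfl⟩
        obtain ⟨q, rfl⟩ := sinhMap_surjective (u₀ := u₀) (v₀ := v₀) ha hb p
        exact ⟨q, hp, sinhCoshSurface_eq ha hb (h _ hp)⟩

end Parametrization

end DeSitter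

/-! ### The equivalence -/

theorem theorem6p1 (U : Set (ℝ × ℝ)) (hUo : IsOpen U) (hUc : IsConnected U)
    (f : ℝ × ℝ → ℝ) (hf : ContDiffOn ℝ ∞ f U)
    (hpos : ∀ p ∈ U, DeSitter.graphSurface f p ∈ DeSitter.halfSpace) :
    List.TFAE [
      DeSitter.IsSpacelike (DeSitter.graphSurface f) U ∧
        DeSitter.IsTranslational f U ∧
        ¬ DeSitter.IsPlanar f U ∧
        DeSitter.HasConformalNormalGaussMap (DeSitter.graphSurface f) U,
      (∀ p ∈ U, fderiv ℝ f p (1, 0) ^ 2 + fderiv ℝ f p (0, 1) ^ 2 < 1) ∧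
        ∃ a b u₀ v₀ : ℝ, a ≠ 0 ∧ b ≠ 0 ∧
          ((∀ p ∈ U, f p =
              Real.sqrt (a ^ 2 + (p.1 - u₀) ^ 2) + Real.sqrt (b ^ 2 + (p.2 - v₀) ^ 2)) ∨
            (∀ p ∈ U, f p =
              Real.sqrt (a ^ 2 + (p.1 - u₀) ^ 2) - Real.sqrt (b ^ 2 + (p.2 - v₀) ^ 2)) ∨
            (∀ p ∈ U, f p =
              Real.sqrt (b ^ 2 + (p.2 - v₀) ^ 2) - Real.sqrt (a ^ 2 + (p.1 - u₀) ^ 2))),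
      ∃ a b u₀ v₀ : ℝ, a ≠ 0 ∧ b ≠ 0 ∧ ∃ D : Set (ℝ × ℝ), IsOpen D ∧
        DeSitter.IsSpacelike (DeSitter.sinhCoshSurface a b u₀ v₀) D ∧
        Set.InjOn (DeSitter.sinhCoshSurface a b u₀ v₀) D ∧
        DeSitter.sinhCoshSurface a b u₀ v₀ '' D = DeSitter.graphSurface f '' U] := by
  have hp : ∀ p ∈ U, 0 < f p := hpos
  obtain ⟨p₀, hp₀⟩ := hUc.nonempty
  have grad : ∀ {a b u₀ v₀ : ℝ},
      (∀ p ∈ U, f p = DeSitter.branch a u₀ p.1 + DeSitter.branch b v₀ p.2) →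
      (DeSitter.IsSpacelike (DeSitter.graphSurface f) U ↔
        ∀ p ∈ U, fderiv ℝ f p (1, 0) ^ 2 + fderiv ℝ f p (0, 1) ^ 2 < 1) := by
    intro a b u₀ v₀ h
    have hs := DeSitter.isSmoothSum_branch h
    rw [hs.isSpacelike_iff hUo hp]
    refine forall₂_congr fun p hpU => ?_
    rw [(hs.hasFDerivAt hUo hpU).fderiv]
    simp
  tfae_have 1 → 3 := by
    rintro ⟨hs, ⟨φ, ψ, hφψ⟩, hpl, hc⟩
    have h := DeSitter.isSmoothSum_of_isTranslational hUo hf hφψ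
    have hlt := (h.isSpacelike_iff hUo hp).1 hs
    obtain ⟨a, b, u₀, v₀, ha, hb, hab⟩ := h.eq_branch_add_branch hUo hUc hlt
      (fun p hpU => h.conformal_equation hUo hlt
        (fun q hq => h.exists_pointwiseConformal hUo hp hlt hc hq) hpU) hpl
    exact ⟨a, b, u₀, v₀, ha, hb, (DeSitter.exists_parametrization_iff ha hb hUo).2 ⟨hs, hab⟩⟩
  tfae_have 3 → 2 := by
    rintro ⟨a, b, u₀, v₀, ha, hb, hD⟩
    obtain ⟨hs, h⟩ := (DeSitter.exists_parametrization_iff ha hb hUo).1 hD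
    refine ⟨(grad h).1 hs, a, b, u₀, v₀, ha, hb, ?_⟩
    -- The signs of `a` and `b` select the formula; two negative signs contradict `f > 0`.
    rcases ha.lt_or_gt with ha' | ha' <;> rcases hb.lt_or_gt with hb' | hb'
    · exfalso
      have h1 := h p₀ hp₀
      rw [DeSitter.branch_of_neg ha', DeSitter.branch_of_neg hb'] at h1
      linarith [hp p₀ hp₀, Real.sqrt_nonneg (a ^ 2 + (p₀.1 - u₀) ^ 2),
        Real.sqrt_nonneg (b ^ 2 + (p₀.2 - v₀) ^ 2)]
    · refine Or.inr (Or.inr fun p hpU => ?_)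
      rw [h p hpU, DeSitter.branch_of_neg ha', DeSitter.branch_of_pos hb']
      ring
    · refine Or.inr (Or.inl fun p hpU => ?_)
      rw [h p hpU, DeSitter.branch_of_pos ha', DeSitter.branch_of_neg hb']
      ring
    · refine Or.inl fun p hpU => ?_
      rw [h p hpU, DeSitter.branch_of_pos ha', DeSitter.branch_of_pos hb']
  tfae_have 2 → 1 := by
    rintro ⟨hlt, a, b, u₀, v₀, ha, hb, h⟩
    obtain ⟨a, b, ha, hb, h⟩ : ∃ a b : ℝ, a ≠ 0 ∧ b ≠ 0 ∧
        ∀ p ∈ U, f p = DeSitter.branch a u₀ p.1 + DeSitter.branch b v₀ p.2 := by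
      have ha' := abs_ne_zero.2 ha
      have hb' := abs_ne_zero.2 hb
      rcases h with h | h | h
      · refine ⟨|a|, |b|, ha', hb', fun p hpU => ?_⟩
        rw [h p hpU, DeSitter.branch_abs ha, DeSitter.branch_abs hb]
      · refine ⟨|a|, -|b|, ha', neg_ne_zero.2 hb', fun p hpU => ?_⟩
        rw [h p hpU, DeSitter.branch_neg, DeSitter.branch_abs ha, DeSitter.branch_abs hb]
        ring
      · refine ⟨-|a|, |b|, neg_ne_zero.2 ha', hb', fun p hpU => ?_⟩
        rw [h p hpU, DeSitter.branch_neg, DeSitter.branch_abs ha, DeSitter.branch_abs hb]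
        ring
    have hs := DeSitter.isSmoothSum_branch h
    have hsp := (grad h).2 hlt
    refine ⟨hsp, ⟨_, _, h⟩, hs.not_isPlanar hUo hp₀ ?_,
      hs.hasConformalNormalGaussMap hUo hp ((hs.isSpacelike_iff hUo hp).1 hsp) fun p hpU => ?_⟩
    · rw [DeSitter.deriv_deriv_branch ha]
      have h1 : 0 < Real.sqrt (1 + ((p₀.1 - u₀) / a) ^ 2) := Real.sqrt_pos.2 (by positivity)
      exact one_div_ne_zero (mul_ne_zero ha (pow_ne_zero 3 h1.ne'))
    · rw [h p hpU]
      exact DeSitter.branch_conformal_equation ha hb u₀ v₀ p.1 p.2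
  tfae_finish
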